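/- **Proposition 1 (Poisson property).** Call a random countable set $X$ a Poisson point process with mean measure $\Lambda$ if for every Borel set $B$ the number $X(B)=\#(X\cap B)$ is a Poisson random variable with mean $\Lambda(B)\in[0,\infty]$ (with $X(B)=\infty$ almost surely if $\Lambda(B)=\infty$), and $X(B_1),\dots,X(B_n)$ are independent for pairwise disjoint Borel sets $B_1,\dots,B_n$. Let $d\ge 1$, $\alpha>0$, $s>0$. Let $\{y_i\}_{i\in\mathbb N}$ be the (almost surely distinct) points of a stationary Poisson point process of intensity $1$ in $\mathbb R^d$, ordered by their Euclidean distance $r_i=\|y_i\|$ to the origin. Let $f_1,f_2,\dots$ be iid random variables, independent of $\{y_i\}$, with a distribution $F$ on $[0,\infty)$ of mean $1$. Put $x_i=r_i^\alpha$ and $\xi_i=x_i/f_i$ (a node with $f_i=0$ has $\xi_i=\infty$ and contributes no point to $\Xi$), and let $$\Phi=\{x_i\},\qquad \Xi=\{\xi_i\},\qquad \hat\Xi=\{\xi_i:\xi_i<1/s\}=\Xi\cap[0,1/s).$$ Then $\Phi$, $\Xi$ and $\hat\Xi$ are Poisson point processes on $\mathbb R^+=[0,\infty)$. The mean measure of $\Phi$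 is locally finite, that of $\Xi$ is locally finite if $\int_0^\infty x^{d/\alpha}\,dF(x)<\infty$, and that of $\hat\Xi$ is the restriction of the mean measure of $\Xi$ to $[0,1/s)$. -/

import Mathlib

open MeasureTheory ProbabilityTheory Set
open scoped ENNReal NNReal

noncomputable section

open Classical in
/-- The Poisson distribution on `{0, 1, 2, …} ∪ {∞}` with mean `m ∈ [0, ∞]`; for `m = ∞` it is
the point mass at `∞`. -/
def poissonLaw (m : ℝ≥0∞) : Measure ℕ∞ :=
  if m = ∞ then Measure.dirac ⊤
  else (poissonMeasure m.toNNReal).map (fun n : ℕ => (n : ℕ∞))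

/-- The number of points of the random set `X` in `B`. -/
def pointCount {Ω S : Type*} (X : Ω → Set S) (B : Set S) (ω : Ω) : ℕ∞ :=
  (X ω ∩ B).encard

/-- The random set `X` is a Poisson point process with mean measure `Λ`: it is countable, the
number of points in a measurable set `B` is a Poisson random variable with mean `Λ B`, and the
numbers of points in disjoint measurable sets are independent. -/
structure IsPoissonProcess {Ω S : Type*} [MeasurableSpace Ω] [MeasurableSpace S]
    (P : Measure Ω) (X : Ω → Set S) (Λ : Measure S) : Prop where
  countable : ∀ ω, (X ω).Countable
  measurable_count : ∀ B : Set S, MeasurableSet B → Measurable (pointCount X B)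
  law_count : ∀ B : Set S, MeasurableSet B → P.map (pointCount X B) = poissonLaw (Λ B)
  indep_count : ∀ (n : ℕ) (B : Fin n → Set S), (∀ k, MeasurableSet (B k)) →
    Pairwise (fun k l => Disjoint (B k) (B l)) → iIndepFun (fun k => pointCount X (B k)) P

/-- The path loss process `Φ = {x_i}`, where `x_i = ‖y_i‖ ^ α`. -/
def pathLossProcess {Ω : Type*} {d : ℕ} (α : ℝ) (y : ℕ → Ω → EuclideanSpace ℝ (Fin d))
    (ω : Ω) : Set ℝ :=
  {z | ∃ i, z = ‖y i ω‖ ^ α}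

/-- The path loss process with fading `Ξ = {ξ_i}`, where `ξ_i = x_i / f_i`. A node with `f_i = 0`
has infinite path loss, hence contributes no point. -/
def fadingPathLossProcess {Ω : Type*} {d : ℕ} (α : ℝ) (y : ℕ → Ω → EuclideanSpace ℝ (Fin d))
    (f : ℕ → Ω → ℝ) (ω : Ω) : Set ℝ :=
  {z | ∃ i, 0 < f i ω ∧ z = ‖y i ω‖ ^ α / f i ω}

/-- The path losses with fading of the nodes connected to the origin, `Ξ ∩ [0, 1/s)`. -/
def connectedFadingPathLossProcess {Ω : Type*} {d : ℕ} (α s : ℝ)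
    (y : ℕ → Ω → EuclideanSpace ℝ (Fin d)) (f : ℕ → Ω → ℝ) (ω : Ω) : Set ℝ :=
  fadingPathLossProcess α y f ω ∩ Ico 0 (1 / s)

end

/-! The marked points `(y_i, f_i)` form a Poisson process on `ℝ^d × ℝ` with mean measure
`volume.prod F` (marking). `Ξ` is the image of its part with positive mark under `(x, u) ↦ ‖x‖ ^ α /
u` (mapping), the third process is a restriction of `Ξ`, and `Φ` is the case of constant fading `1`.

Both theorems rest on the Laplace functional `E exp (-∑ v(z_i)) = exp (-∫ (1 - exp (-v)) dμ)`. A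
Poisson process satisfies it (`IsPoissonProcess.hasPoissonLaplace`), and it determines the joint law
of the counts (`HasPoissonLaplace.map_encard`). Marking amounts to integrating out the marks
(`HasPoissonLaplace.marked`). In mapping, a set forgets multiplicities, so the image points must be
almost surely distinct (`HasPoissonLaplace.ae_injOn`). This follows from second moments, because
off-diagonal pairs of points have intensity dominated by `μ.prod μ` and spheres are null. -/

/-- The map `x ↦ exp (-x)` from `[0, ∞]` to `[0, 1]`. -/
noncomputable def expNeg (x : ℝ≥0∞) : ℝ≥0∞ := EReal.exp (-(x : EReal))

lemma expNeg_zero : expNeg 0 = 1 := by simp [expNeg]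

lemma expNeg_le_one (x : ℝ≥0∞) : expNeg x ≤ 1 := by
  simpa [expNeg] using EReal.coe_ennreal_nonneg x

lemma expNeg_ne_top (x : ℝ≥0∞) : expNeg x ≠ ∞ :=
  ((expNeg_le_one x).trans_lt ENNReal.one_lt_top).ne

lemma expNeg_add (x y : ℝ≥0∞) : expNeg (x + y) = expNeg x * expNeg y := by
  rw [expNeg, EReal.coe_ennreal_add, EReal.neg_add (by simp) (by simp), sub_eq_add_neg,
    EReal.exp_add]
  rfl

lemma expNeg_sum {ι : Type*} (s : Finset ι) (x : ι → ℝ≥0∞) :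
    expNeg (∑ i ∈ s, x i) = ∏ i ∈ s, expNeg (x i) := by
  classical
  induction s using Finset.induction_on with
  | empty => simp [expNeg_zero]
  | insert a s ha ih => rw [Finset.sum_insert ha, Finset.prod_insert ha, expNeg_add, ih]

lemma expNeg_natCast_mul (n : ℕ) (x : ℝ≥0∞) : expNeg (n * x) = expNeg x ^ n := by
  induction n with
  | zero => simp [expNeg_zero]
  | succ n ih => rw [Nat.cast_succ, add_mul, one_mul, expNeg_add, ih, pow_succ]

lemma expNeg_ofReal {x : ℝ} (hx : 0 ≤ x) :
    expNeg (ENNReal.ofReal x) = ENNReal.ofReal (Real.exp (-x)) := by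
  rw [expNeg, EReal.coe_ennreal_ofReal, max_eq_left hx, ← EReal.coe_neg, EReal.exp_coe]

lemma continuous_expNeg : Continuous expNeg :=
  ENNReal.continuous_exp.comp (continuous_neg.comp continuous_coe_ennreal_ereal)

@[fun_prop]
lemma measurable_expNeg : Measurable expNeg := continuous_expNeg.measurable

lemma strictAnti_expNeg : StrictAnti expNeg := fun x y h => by
  simpa [expNeg] using h

/-- A right inverse of `expNeg` on `[0, 1]`. -/
noncomputable def negLog (x : ℝ≥0∞) : ℝ≥0∞ := (-ENNReal.log x).toENNReal

@[fun_prop]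
lemma measurable_negLog : Measurable negLog := by
  unfold negLog
  fun_prop

lemma expNeg_negLog {x : ℝ≥0∞} (hx : x ≤ 1) : expNeg (negLog x) = x := by
  rw [expNeg, negLog, EReal.coe_toENNReal, neg_neg, ENNReal.exp_log]
  simpa [EReal.le_neg] using hx

/-! ### Moment problem on the cube -/

/-- Finite measures on a cube are determined by their mixed moments. -/
lemma ext_of_moments {ι : Type*} [Fintype ι] {P Q : Measure (ι → unitInterval)}
    [IsFiniteMeasure P] [IsFiniteMeasure Q]
    (h : ∀ m : ι → ℕ, ∫ x, ∏ i, (x i : ℝ) ^ m i ∂P = ∫ x, ∏ i, (x i : ℝ) ^ m i ∂Q) :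
    P = Q := by
  classical
  let X : ι → BoundedContinuousFunction (ι → unitInterval) ℝ := fun i =>
    BoundedContinuousFunction.mkOfCompact ⟨fun x => (x i : ℝ), by fun_prop⟩
  let A : StarSubalgebra ℝ (BoundedContinuousFunction (ι → unitInterval) ℝ) :=
    StarAlgebra.adjoin ℝ (range X)
  have hmon : ∀ g ∈ Submonoid.closure (range X),
      ∃ m : ι → ℕ, ∀ x, g x = ∏ i, (x i : ℝ) ^ m i := by
    intro g hg
    induction hg using Submonoid.closure_induction with
    | mem g hg =>
      obtain ⟨i, rfl⟩ := hg
      refine ⟨Pi.single i 1, fun x => ?_⟩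
      rw [Finset.prod_eq_single i]
      · simp [X]
      · intro j _ hj
        simp [hj]
      · simp
    | one => exact ⟨0, by simp⟩
    | mul g g' _ _ hg hg' =>
      obtain ⟨m, hm⟩ := hg
      obtain ⟨m', hm'⟩ := hg'
      exact ⟨m + m', fun x => by simp [hm, hm', pow_add, Finset.prod_mul_distrib]⟩
  refine ext_of_forall_mem_subalgebra_integral_eq_of_pseudoEMetric_complete_countable
    (𝕜 := ℝ) (A := A) ?_ ?_
  · intro x y hxy
    obtain ⟨i, hi⟩ := Function.ne_iff.1 hxy
    refine ⟨X i, ⟨_, ⟨X i, StarAlgebra.subset_adjoin ℝ _ ⟨i, rfl⟩, rfl⟩, rfl⟩, ?_⟩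
    simpa [X, Subtype.ext_iff] using hi
  · intro g hg
    have hX : ∀ i, star (X i) = X i := fun i => by
      ext x
      simp [X]
    have hstar : star (range X) = range X := by
      rw [← Set.image_star, ← Set.range_comp]
      exact congrArg range (funext hX)
    -- The coordinates are real, so the star operation adds no generators: the algebra is the linear
    -- span of the monomials, and moments decide every integral over it.
    have hg' : g ∈ Submodule.span ℝ (Submonoid.closure (range X) : Set _) := by
      rw [← Algebra.adjoin_eq_span]
      rw [← StarSubalgebra.mem_toSubalgebra, StarAlgebra.adjoin_toSubalgebra, hstar,
        Set.union_self] at hg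
      exact hg
    clear hg
    induction hg' using Submodule.span_induction with
    | mem g hg =>
      obtain ⟨m, hm⟩ := hmon g hg
      simp_rw [hm]
      exact h m
    | zero => simp
    | add g g' _ _ hg hg' =>
      simp only [BoundedContinuousFunction.coe_add, Pi.add_apply]
      rw [integral_add (g.integrable P) (g'.integrable P),
        integral_add (g.integrable Q) (g'.integrable Q), hg, hg']
    | smul c g _ hg =>
      simp only [BoundedContinuousFunction.coe_smul, integral_smul, hg]

/-! ### Laplace transform and moments of the Poisson law -/

lemma lintegral_poissonMeasure (r : ℝ≥0) (g : ℕ → ℝ≥0∞) :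
    ∫⁻ n, g n ∂poissonMeasure r =
      ∑' n : ℕ, ENNReal.ofReal (Real.exp (-r) * r ^ n / n.factorial) * g n := by
  rw [poissonMeasure, lintegral_sum_measure]
  simp [lintegral_smul_measure]

lemma lintegral_poissonLaw_of_ne_top {m : ℝ≥0∞} (hm : m ≠ ∞) (g : ℕ∞ → ℝ≥0∞) :
    ∫⁻ n, g n ∂poissonLaw m = ∫⁻ n : ℕ, g n ∂poissonMeasure m.toNNReal := by
  rw [poissonLaw, if_neg hm, lintegral_map .of_discrete .of_discrete]

instance isProbabilityMeasure_poissonLaw (m : ℝ≥0∞) : IsProbabilityMeasure (poissonLaw m) := by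
  unfold poissonLaw
  split_ifs
  · infer_instance
  · exact Measure.isProbabilityMeasure_map .of_discrete

/-- The Laplace transform of the Poisson distribution. -/
lemma lintegral_expNeg_poissonLaw (m c : ℝ≥0∞) :
    ∫⁻ n : ℕ∞, expNeg (c * n) ∂poissonLaw m = expNeg ((1 - expNeg c) * m) := by
  by_cases hm : m = ∞
  · subst hm
    rw [poissonLaw, if_pos rfl, lintegral_dirac]
    -- The convention `0 * ∞ = 0` makes both sides `1` when `c = 0`; otherwise both vanish.
    rcases eq_or_ne c 0 with rfl | hc
    · simp [expNeg_zero]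
    · have h : expNeg c < 1 := expNeg_zero ▸ strictAnti_expNeg (pos_iff_ne_zero.2 hc)
      rw [ENat.toENNReal_top, ENNReal.mul_top hc, ENNReal.mul_top (tsub_pos_of_lt h).ne']
  · rw [lintegral_poissonLaw_of_ne_top hm, lintegral_poissonMeasure]
    lift m to ℝ≥0 using hm
    obtain ⟨t, ht⟩ : ∃ t : ℝ≥0, expNeg c = t := ⟨_, (ENNReal.coe_toNNReal (expNeg_ne_top c)).symm⟩
    have ht1 : t ≤ 1 := by exact_mod_cast ht ▸ expNeg_le_one c
    -- With `t = exp (-c)` the transform is the generating function at `t`, an exponential series in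
    -- `t * m`.
    have key : HasSum (fun n : ℕ => Real.exp (-m) * ((t * m : ℝ) ^ n / n.factorial))
        (Real.exp (-m) * Real.exp (t * m)) := by
      rw [Real.exp_eq_exp_ℝ]
      exact (NormedSpace.expSeries_div_hasSum_exp (t * m : ℝ)).mul_left _
    have hterm : ∀ n : ℕ, ENNReal.ofReal (Real.exp (-m) * m ^ n / n.factorial)
        * expNeg (c * ((n : ℕ∞) : ℝ≥0∞))
        = ENNReal.ofReal (Real.exp (-m) * ((t * m : ℝ) ^ n / n.factorial)) := fun n => by
      rw [ENat.toENNReal_coe, mul_comm c, expNeg_natCast_mul, ht, ← ENNReal.ofReal_coe_nnreal,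
        ← ENNReal.ofReal_pow (by positivity), ← ENNReal.ofReal_mul (by positivity), mul_pow]
      congr 1
      ring
    simp only [ENNReal.toNNReal_coe]
    rw [tsum_congr hterm, ← ENNReal.ofReal_tsum_of_nonneg (fun n => by positivity) key.summable,
      key.tsum_eq, ← Real.exp_add, ht]
    have : (1 - (t : ℝ≥0∞)) * m = ENNReal.ofReal ((1 - t) * m) := by
      rw [ENNReal.ofReal_mul (by simpa using ht1), ENNReal.ofReal_sub _ (by positivity)]
      simp
    rw [this, expNeg_ofReal (mul_nonneg (by simpa using ht1) (by positivity))]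
    congr 2
    ring

lemma poissonMeasure_weight_succ (r : ℝ≥0) (n : ℕ) :
    ENNReal.ofReal (Real.exp (-r) * r ^ (n + 1) / (n + 1).factorial) * ((n + 1 : ℕ) : ℝ≥0∞) =
      r * ENNReal.ofReal (Real.exp (-r) * r ^ n / n.factorial) := by
  rw [← ENNReal.ofReal_natCast, ← ENNReal.ofReal_mul (by positivity),
    ← ENNReal.ofReal_coe_nnreal (p := r), ← ENNReal.ofReal_mul (by positivity)]
  congr 1
  rw [Nat.factorial_succ]
  push_cast
  field_simp
  ring

/-- The Stein–Chen identity: the factor `n` cancels in the factorial and shifts the series. Taking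
`g = 1` and `g n = n` gives the first two moments. -/
lemma lintegral_natCast_mul_poissonMeasure (r : ℝ≥0) (g : ℕ → ℝ≥0∞) :
    ∫⁻ n, n * g n ∂poissonMeasure r = r * ∫⁻ n, g (n + 1) ∂poissonMeasure r := by
  rw [lintegral_poissonMeasure, lintegral_poissonMeasure,
    tsum_eq_zero_add' ENNReal.summable, ← ENNReal.tsum_mul_left]
  simp only [Nat.cast_zero, zero_mul, mul_zero, zero_add]
  refine tsum_congr fun n => ?_
  rw [← mul_assoc, poissonMeasure_weight_succ, mul_assoc]

/-- The mean of the Poisson distribution. -/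
lemma lintegral_poissonLaw {m : ℝ≥0∞} (hm : m ≠ ∞) :
    ∫⁻ n : ℕ∞, (n : ℝ≥0∞) ∂poissonLaw m = m := by
  rw [lintegral_poissonLaw_of_ne_top hm]
  have := lintegral_natCast_mul_poissonMeasure m.toNNReal fun _ => 1
  simpa [hm] using this

/-- The second moment of the Poisson distribution. -/
lemma lintegral_mul_self_poissonLaw {m : ℝ≥0∞} (hm : m ≠ ∞) :
    ∫⁻ n : ℕ∞, (n : ℝ≥0∞) * n ∂poissonLaw m = m * m + m := by
  have h1 := lintegral_poissonLaw hm
  rw [lintegral_poissonLaw_of_ne_top hm] at h1 ⊢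
  simp only [ENat.toENNReal_coe] at h1 ⊢
  rw [lintegral_natCast_mul_poissonMeasure]
  simp only [Nat.cast_add, Nat.cast_one]
  rw [lintegral_add_right _ (by fun_prop), h1]
  simp [hm, mul_add]

/-! ### Joint Laplace transforms determine laws of counts -/

/-- The embedding `n ↦ exp (-n)` of `ℕ ∪ {∞}` into the unit interval. -/
noncomputable def expNegUnit (n : ℕ∞) : unitInterval :=
  ⟨(expNeg n).toReal, ENNReal.toReal_nonneg,
    ENNReal.toReal_le_of_le_ofReal zero_le_one (by simpa using expNeg_le_one n)⟩

lemma expNegUnit_injective : Function.Injective expNegUnit := fun m n h => by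
  rw [Subtype.ext_iff] at h
  exact ENat.toENNReal_inj.1 (strictAnti_expNeg.injective
    ((ENNReal.toReal_eq_toReal_iff' (expNeg_ne_top _) (expNeg_ne_top _)).1 h))

lemma measurableEmbedding_expNegUnit_pi (ι : Type*) [Finite ι] :
    MeasurableEmbedding fun (x : ι → ℕ∞) i => expNegUnit (x i) where
  injective _ _ h := funext fun i => expNegUnit_injective (congrFun h i)
  measurable := measurable_pi_lambda _ fun i =>
    (Measurable.of_discrete (f := expNegUnit)).comp (measurable_pi_apply i)
  measurableSet_image' s _ := (s.to_countable.image _).measurableSet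

/-- Moments on the cube are Laplace transforms at integer arguments, so these arguments suffice to
identify a law. Infinite counts go to `0`, and `0 ^ 0 = 1` matches `0 * ∞ = 0`. -/
lemma integral_prod_expNegUnit {ι : Type*} [Fintype ι] (Q : Measure (ι → ℕ∞)) (m : ι → ℕ) :
    ∫ x, ∏ i, (x i : ℝ) ^ m i ∂Q.map (fun (x : ι → ℕ∞) i => expNegUnit (x i)) =
      (∫⁻ x, expNeg (∑ i, m i * x i) ∂Q).toReal := by
  rw [(measurableEmbedding_expNegUnit_pi ι).integral_map, ← integral_toReal]
  · simp [expNegUnit, expNeg_sum, expNeg_natCast_mul, ENNReal.toReal_prod]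
  · exact Measurable.aemeasurable .of_discrete
  · exact .of_forall fun x => (expNeg_ne_top _).lt_top

lemma lintegral_expNeg_pi_poissonLaw {ι : Type*} [Fintype ι] (m c : ι → ℝ≥0∞) :
    ∫⁻ x : ι → ℕ∞, expNeg (∑ i, c i * x i) ∂Measure.pi (fun i => poissonLaw (m i)) =
      ∏ i, expNeg ((1 - expNeg (c i)) * m i) := by
  simp_rw [expNeg_sum]
  rw [lintegral_prod_eq_prod_lintegral_of_indepFun Finset.univ
    (fun i (x : ι → ℕ∞) => expNeg (c i * x i))]
  · refine Finset.prod_congr rfl fun i _ => ?_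
    rw [← lintegral_expNeg_poissonLaw]
    exact (measurePreserving_eval (fun i => poissonLaw (m i)) i).lintegral_comp
      (f := fun n : ℕ∞ => expNeg (c i * n)) .of_discrete
  · exact iIndepFun_pi (μ := fun i => poissonLaw (m i)) (X := fun i n => expNeg (c i * n))
      fun i => Measurable.aemeasurable .of_discrete
  · exact fun i => Measurable.of_discrete

/-- Counts with the joint Laplace transform of independent Poisson variables are independent
Poisson variables. -/
lemma map_eq_pi_poissonLaw {Ω ι : Type*} [MeasurableSpace Ω] {P : Measure Ω}
    [IsProbabilityMeasure P] [Fintype ι] {N : ι → Ω → ℕ∞} (hN : ∀ i, Measurable (N i))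
    {m : ι → ℝ≥0∞}
    (h : ∀ c : ι → ℕ, ∫⁻ ω, expNeg (∑ i, c i * N i ω) ∂P =
      ∏ i, expNeg ((1 - expNeg (c i)) * m i)) :
    P.map (fun ω i => N i ω) = Measure.pi fun i => poissonLaw (m i) := by
  have hN' : Measurable fun ω i => N i ω := measurable_pi_lambda _ hN
  have := Measure.isProbabilityMeasure_map (μ := P) hN'.aemeasurable
  apply (measurableEmbedding_expNegUnit_pi ι).map_injective
  apply ext_of_moments
  intro c
  rw [integral_prod_expNegUnit, integral_prod_expNegUnit, lintegral_expNeg_pi_poissonLaw,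
    lintegral_map .of_discrete hN', h]

/-! ### Laplace functional of a Poisson process -/

lemma tsum_indicator_one_eq_encard {ι S : Type*} (z : ι → S) (B : Set S) :
    ∑' i, B.indicator (1 : S → ℝ≥0∞) (z i) = ({i | z i ∈ B}.encard : ℝ≥0∞) := by
  rw [← ENNReal.tsum_set_one, tsum_subtype {i | z i ∈ B} fun _ => (1 : ℝ≥0∞)]
  rfl

/-- Points of a set carry no multiplicity; injectivity is what allows counting indices instead. -/
lemma pointCount_range {Ω S : Type*} {z : ℕ → Ω → S} {ω : Ω}
    (h : Function.Injective fun i => z i ω) (B : Set S) :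
    pointCount (fun ω => range fun i => z i ω) B ω = {i | z i ω ∈ B}.encard := by
  rw [pointCount, inter_comm, ← image_preimage_eq_inter_range, h.encard_image]
  rfl

/-- The random sequence `z` has the Laplace functional of a Poisson process with mean
measure `μ`. -/
def HasPoissonLaplace {Ω S : Type*} [MeasurableSpace Ω] [MeasurableSpace S] (P : Measure Ω)
    (z : ℕ → Ω → S) (μ : Measure S) : Prop :=
  ∀ v : S → ℝ≥0∞, Measurable v →
    ∫⁻ ω, expNeg (∑' i, v (z i ω)) ∂P = expNeg (∫⁻ x, (1 - expNeg (v x)) ∂μ)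

lemma tsum_simpleFunc {S : Type*} [MeasurableSpace S] (v : SimpleFunc S ℝ≥0∞) (x : ℕ → S) :
    ∑' i, v (x i) = ∑ c ∈ v.range, c * ({i | x i ∈ v ⁻¹' {c}}.encard : ℝ≥0∞) := by
  simp_rw [← tsum_indicator_one_eq_encard, ← ENNReal.tsum_mul_left]
  rw [← Summable.tsum_finsetSum fun _ _ => ENNReal.summable]
  refine tsum_congr fun i => ?_
  rw [Finset.sum_eq_single (v (x i))]
  · simp
  · intro c _ hc
    simp [hc.symm]
  · simp

lemma tendsto_tsum_of_monotone {S : Type*} {w : ℕ → S → ℝ≥0∞} {v : S → ℝ≥0∞} (hw : Monotone w)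
    (h : ∀ x, Filter.Tendsto (fun n => w n x) Filter.atTop (nhds (v x))) (x : ℕ → S) :
    Filter.Tendsto (fun n => ∑' i, w n (x i)) Filter.atTop (nhds (∑' i, v (x i))) := by
  simp_rw [← lintegral_count]
  exact lintegral_tendsto_of_tendsto_of_monotone (fun n => Measurable.aemeasurable .of_discrete)
    (.of_forall fun i m n hmn => hw hmn (x i)) (.of_forall fun i => h _)

section

variable {Ω S : Type*} [MeasurableSpace Ω] [MeasurableSpace S] {P : Measure Ω}
 {z : ℕ → Ω → S} {μ : Measure S}

/-- The fibres of `v` are disjoint, so the sum is a combination of independent Poisson counts and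
its Laplace transform factors. -/
lemma IsPoissonProcess.laplace_simpleFunc
    (h : IsPoissonProcess P (fun ω => range fun i => z i ω) μ)
    (hinj : ∀ᵐ ω ∂P, Function.Injective fun i => z i ω) (v : SimpleFunc S ℝ≥0∞) :
    ∫⁻ ω, expNeg (∑' i, v (z i ω)) ∂P = expNeg (∫⁻ x, (1 - expNeg (v x)) ∂μ) := by
  let X : Ω → Set S := fun ω => range fun i => z i ω
  let e := v.range.equivFin.symm
  let B : Fin v.range.card → Set S := fun k => v ⁻¹' {(e k : ℝ≥0∞)}
  have hB : ∀ k, MeasurableSet (B k) := fun k => v.measurableSet_fiber _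
  have hdisj : Pairwise fun k l => Disjoint (B k) (B l) := fun k l hkl =>
    Disjoint.preimage _ (disjoint_singleton.2 fun h => hkl (e.injective (Subtype.ext h)))
  have hsum : ∀ g : ℝ≥0∞ → ℝ≥0∞, ∑ c ∈ v.range, g c = ∑ k, g (e k) := fun g => by
    rw [← Finset.sum_coe_sort, ← e.sum_comp]
  have hind := h.indep_count _ B hB hdisj
  calc ∫⁻ ω, expNeg (∑' i, v (z i ω)) ∂P
      = ∫⁻ ω, ∏ k, expNeg (e k * pointCount X (B k) ω) ∂P := by
        refine lintegral_congr_ae (hinj.mono fun ω hω => ?_)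
        simp only
        rw [tsum_simpleFunc v fun i => z i ω, hsum, expNeg_sum]
        refine Finset.prod_congr rfl fun k _ => ?_
        rw [pointCount_range hω]
    _ = ∏ k, ∫⁻ ω, expNeg (e k * pointCount X (B k) ω) ∂P := by
        refine lintegral_prod_eq_prod_lintegral_of_indepFun Finset.univ
          (fun k ω => expNeg (e k * pointCount X (B k) ω))
          (hind.comp (fun k (n : ℕ∞) => expNeg (e k * n)) fun k => .of_discrete) fun k => ?_
        exact (Measurable.of_discrete (f := fun n : ℕ∞ => expNeg (e k * n))).comp
          (h.measurable_count _ (hB k))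
    _ = ∏ k, expNeg ((1 - expNeg (e k)) * μ (B k)) := by
        refine Finset.prod_congr rfl fun k _ => ?_
        rw [← lintegral_expNeg_poissonLaw, ← h.law_count _ (hB k),
          lintegral_map .of_discrete (h.measurable_count _ (hB k))]
    _ = expNeg (∫⁻ x, (1 - expNeg (v x)) ∂μ) := by
        rw [← expNeg_sum, ← hsum fun c => (1 - expNeg c) * μ (v ⁻¹' {c}),
          ← SimpleFunc.map_lintegral, ← SimpleFunc.lintegral_eq_lintegral]
        rfl

lemma tendsto_lintegral_expNeg [IsProbabilityMeasure P] {T : ℕ → Ω → ℝ≥0∞} {T' : Ω → ℝ≥0∞} (hT : ∀ n, Measurable (T n))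
    (h : ∀ ω, Filter.Tendsto (fun n => T n ω) Filter.atTop (nhds (T' ω))) :
    Filter.Tendsto (fun n => ∫⁻ ω, expNeg (T n ω) ∂P) Filter.atTop
      (nhds (∫⁻ ω, expNeg (T' ω) ∂P)) :=
  tendsto_lintegral_of_dominated_convergence (fun _ => 1) (fun n => by fun_prop)
    (fun n => .of_forall fun ω => expNeg_le_one _) (by simp)
    (.of_forall fun ω => (continuous_expNeg.tendsto _).comp (h ω))

/-- The Laplace functional of a Poisson process. -/
theorem IsPoissonProcess.hasPoissonLaplace [IsProbabilityMeasure P] (hz : ∀ i, Measurable (z i))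
    (h : IsPoissonProcess P (fun ω => range fun i => z i ω) μ)
    (hinj : ∀ᵐ ω ∂P, Function.Injective fun i => z i ω) : HasPoissonLaplace P z μ := by
  intro v hv
  let w := SimpleFunc.eapprox v
  have hw : Monotone fun n => (w n : S → ℝ≥0∞) := fun m n hmn =>
    SimpleFunc.monotone_eapprox v hmn
  have hlim : ∀ x, Filter.Tendsto (fun n => w n x) Filter.atTop (nhds (v x)) :=
    SimpleFunc.tendsto_eapprox hv
  -- Simple functions increase to `v`: the left side converges by domination by `1`, the right side
  -- because `1 - exp (-w n)` increases.
  refine tendsto_nhds_unique (tendsto_lintegral_expNeg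
    (T := fun n ω => ∑' i, w n (z i ω)) (fun n => ?_)
    fun ω => tendsto_tsum_of_monotone hw hlim fun i => z i ω) ?_
  · exact Measurable.tsum fun i => (w n).measurable.comp (hz i)
  · simp_rw [h.laplace_simpleFunc hinj]
    refine (continuous_expNeg.tendsto _).comp ?_
    refine lintegral_tendsto_of_tendsto_of_monotone (fun n => by fun_prop)
      (.of_forall fun x m n hmn => tsub_le_tsub_left (strictAnti_expNeg.antitone (hw hmn x)) _)
      (.of_forall fun x => ENNReal.Tendsto.sub tendsto_const_nhds
        ((continuous_expNeg.tendsto _).comp (hlim x)) (.inl ENNReal.one_ne_top))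

end

/-! ### Counts and their second moments from the Laplace functional -/

lemma encard_mem_eq_inter_add_diff {S : Type*} (x : ℕ → S) (A B : Set S) :
    ({i | x i ∈ A}.encard : ℝ≥0∞) = {i | x i ∈ A ∩ B}.encard + {i | x i ∈ A \ B}.encard := by
  rw [← ENat.toENNReal_add, ← Set.encard_union_eq]
  · congr 2
    ext i
    by_cases hi : x i ∈ B <;> simp [hi]
  · exact Set.disjoint_left.2 fun i hi hi' => hi'.2 hi.2

section

variable {Ω S : Type*} [MeasurableSpace Ω] [MeasurableSpace S] {P : Measure Ω}
  {z : ℕ → Ω → S} {μ : Measure S}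

lemma measurable_encard_mem (hz : ∀ i, Measurable (z i)) {B : Set S} (hB : MeasurableSet B) :
    Measurable fun ω => {i | z i ω ∈ B}.encard :=
  measurable_encard.comp (measurable_set_iff.2 fun i => measurableSet_setOfPred.1 (hz i hB))

/-- The Laplace functional determines the counts in disjoint sets: they are independent Poisson
variables. -/
theorem HasPoissonLaplace.map_encard [IsProbabilityMeasure P] (h : HasPoissonLaplace P z μ)
    (hz : ∀ i, Measurable (z i)) {ι : Type*} [Fintype ι] {C : ι → Set S}
    (hC : ∀ k, MeasurableSet (C k)) (hdisj : Pairwise fun k l => Disjoint (C k) (C l)) :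
    P.map (fun ω k => {i | z i ω ∈ C k}.encard) = Measure.pi fun k => poissonLaw (μ (C k)) := by
  classical
  refine map_eq_pi_poissonLaw (fun k => measurable_encard_mem hz (hC k)) fun c => ?_
  let v : S → ℝ≥0∞ := fun x => ∑ k, (c k : ℝ≥0∞) * (C k).indicator 1 x
  have hv : Measurable v := Finset.measurable_fun_sum _ fun k _ =>
    (measurable_one.indicator (hC k)).const_mul _
  have h1 : ∀ ω, ∑' i, v (z i ω) = ∑ k, (c k : ℝ≥0∞) * ({i | z i ω ∈ C k}.encard : ℝ≥0∞) := by
    intro ω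
    simp_rw [← tsum_indicator_one_eq_encard (fun i => z i ω), ← ENNReal.tsum_mul_left]
    rw [← Summable.tsum_finsetSum fun _ _ => ENNReal.summable]
  -- By disjointness at most one term of `v x` is nonzero, so `1 - exp (-·)` passes through the sum.
  have h2 : ∀ x, 1 - expNeg (v x) =
      ∑ k, (1 - expNeg (c k)) * (C k).indicator (1 : S → ℝ≥0∞) x := by
    intro x
    by_cases hx : ∃ k, x ∈ C k
    · obtain ⟨k, hk⟩ := hx
      have hne : ∀ l, l ≠ k → x ∉ C l := fun l hl hxl => (hdisj hl).le_bot ⟨hxl, hk⟩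
      simp only [v]
      rw [Finset.sum_eq_single k, Finset.sum_eq_single k] <;> simp +contextual [hk, hne]
    · push Not at hx
      simp [v, hx, expNeg_zero]
  simp_rw [← h1]
  rw [h v hv, ← expNeg_sum]
  simp_rw [h2]
  rw [lintegral_finsetSum _ fun k _ => (measurable_one.indicator (hC k)).const_mul _]
  congr 1
  refine Finset.sum_congr rfl fun k _ => ?_
  rw [lintegral_const_mul _ (measurable_one.indicator (hC k)), lintegral_indicator_one (hC k)]

theorem HasPoissonLaplace.map_encard_eq_poissonLaw [IsProbabilityMeasure P]
    (h : HasPoissonLaplace P z μ) (hz : ∀ i, Measurable (z i)) {B : Set S}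
    (hB : MeasurableSet B) :
    P.map (fun ω => {i | z i ω ∈ B}.encard) = poissonLaw (μ B) := by
  have := congrArg (Measure.map fun x : Unit → ℕ∞ => x ())
    (h.map_encard hz (C := fun _ : Unit => B) (fun _ => hB) fun k l hkl =>
      absurd (Subsingleton.elim k l) hkl)
  rwa [(measurePreserving_eval (fun _ : Unit => poissonLaw (μ B)) ()).map_eq,
    Measure.map_map .of_discrete
      (measurable_pi_lambda _ fun _ => measurable_encard_mem hz hB)] at this

theorem HasPoissonLaplace.iIndepFun_encard [IsProbabilityMeasure P]
    (h : HasPoissonLaplace P z μ) (hz : ∀ i, Measurable (z i)) {ι : Type*} [Fintype ι]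
    {C : ι → Set S} (hC : ∀ k, MeasurableSet (C k))
    (hdisj : Pairwise fun k l => Disjoint (C k) (C l)) :
    iIndepFun (fun k ω => {i | z i ω ∈ C k}.encard) P := by
  rw [iIndepFun_iff_map_fun_eq_pi_map
    fun k => (measurable_encard_mem hz (hC k)).aemeasurable, h.map_encard hz hC hdisj]
  simp_rw [h.map_encard_eq_poissonLaw hz (hC _)]

lemma HasPoissonLaplace.lintegral_encard [IsProbabilityMeasure P]
    (h : HasPoissonLaplace P z μ) (hz : ∀ i, Measurable (z i)) {B : Set S}
    (hB : MeasurableSet B) (hμ : μ B ≠ ∞) :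
    ∫⁻ ω, ({i | z i ω ∈ B}.encard : ℝ≥0∞) ∂P = μ B := by
  rw [← lintegral_poissonLaw hμ, ← h.map_encard_eq_poissonLaw hz hB,
    lintegral_map .of_discrete (measurable_encard_mem hz hB)]

lemma HasPoissonLaplace.lintegral_encard_mul_self [IsProbabilityMeasure P]
    (h : HasPoissonLaplace P z μ) (hz : ∀ i, Measurable (z i)) {B : Set S}
    (hB : MeasurableSet B) (hμ : μ B ≠ ∞) :
    ∫⁻ ω, ({i | z i ω ∈ B}.encard : ℝ≥0∞) * {i | z i ω ∈ B}.encard ∂P = μ B * μ B + μ B := by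
  rw [← lintegral_mul_self_poissonLaw hμ, ← h.map_encard_eq_poissonLaw hz hB,
    lintegral_map .of_discrete (measurable_encard_mem hz hB)]

lemma measurable_encard_mem_toENNReal (hz : ∀ i, Measurable (z i)) {B : Set S}
    (hB : MeasurableSet B) : Measurable fun ω => ({i | z i ω ∈ B}.encard : ℝ≥0∞) :=
  (Measurable.of_discrete (f := ENat.toENNReal)).comp (measurable_encard_mem hz hB)

lemma HasPoissonLaplace.lintegral_encard_mul_of_disjoint [IsProbabilityMeasure P]
    (h : HasPoissonLaplace P z μ) (hz : ∀ i, Measurable (z i)) {A B : Set S}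
    (hA : MeasurableSet A) (hB : MeasurableSet B) (hAB : Disjoint A B) (hμA : μ A ≠ ∞)
    (hμB : μ B ≠ ∞) :
    ∫⁻ ω, ({i | z i ω ∈ A}.encard : ℝ≥0∞) * {i | z i ω ∈ B}.encard ∂P = μ A * μ B := by
  have hind := h.iIndepFun_encard hz (C := fun b : Bool => cond b A B)
    (by rintro (_ | _) <;> assumption)
    (by rintro (_ | _) (_ | _) hkl <;> first | exact absurd rfl hkl | simpa [disjoint_comm])
  rw [← h.lintegral_encard hz hA hμA, ← h.lintegral_encard hz hB hμB]
  exact lintegral_mul_eq_lintegral_mul_lintegral_of_indepFun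
    (measurable_encard_mem_toENNReal hz hA) (measurable_encard_mem_toENNReal hz hB)
    ((hind.indepFun (show true ≠ false by decide)).comp
      (φ := ENat.toENNReal) (ψ := ENat.toENNReal) .of_discrete .of_discrete)

/-- Splitting along `A ∩ B` leaves products of independent counts and one square; the variance in
that square is the extra `μ (A ∩ B)`. -/
lemma HasPoissonLaplace.lintegral_encard_mul [IsProbabilityMeasure P]
    (h : HasPoissonLaplace P z μ) (hz : ∀ i, Measurable (z i)) {A B : Set S}
    (hA : MeasurableSet A) (hB : MeasurableSet B) (hμA : μ A ≠ ∞) (hμB : μ B ≠ ∞) :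
    ∫⁻ ω, ({i | z i ω ∈ A}.encard : ℝ≥0∞) * {i | z i ω ∈ B}.encard ∂P =
      μ A * μ B + μ (A ∩ B) := by
  have hab := hA.inter hB
  have ha := hA.diff hB
  have hb := hB.diff hA
  have fab : μ (A ∩ B) ≠ ∞ := measure_ne_top_of_subset inter_subset_left hμA
  have fa : μ (A \ B) ≠ ∞ := measure_ne_top_of_subset sdiff_subset hμA
  have fb : μ (B \ A) ≠ ∞ := measure_ne_top_of_subset sdiff_subset hμB
  have key : ∀ ω, ({i | z i ω ∈ A}.encard : ℝ≥0∞) * {i | z i ω ∈ B}.encard =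
      ({i | z i ω ∈ A ∩ B}.encard : ℝ≥0∞) * {i | z i ω ∈ A ∩ B}.encard +
      ({i | z i ω ∈ A ∩ B}.encard : ℝ≥0∞) * {i | z i ω ∈ B \ A}.encard +
      ({i | z i ω ∈ A \ B}.encard : ℝ≥0∞) * {i | z i ω ∈ A ∩ B}.encard +
      ({i | z i ω ∈ A \ B}.encard : ℝ≥0∞) * {i | z i ω ∈ B \ A}.encard := fun ω => by
    rw [encard_mem_eq_inter_add_diff (fun i => z i ω) A B,
      encard_mem_eq_inter_add_diff (fun i => z i ω) B A, inter_comm B A]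
    ring
  have m := measurable_encard_mem_toENNReal hz hab
  have m' := measurable_encard_mem_toENNReal hz ha
  have m'' := measurable_encard_mem_toENNReal hz hb
  simp_rw [key]
  rw [lintegral_add_left (by fun_prop), lintegral_add_left (by fun_prop),
    lintegral_add_left (by fun_prop), h.lintegral_encard_mul_self hz hab fab,
    h.lintegral_encard_mul_of_disjoint hz hab hb
      (disjoint_sdiff_right.mono_left inter_subset_left) fab fb,
    h.lintegral_encard_mul_of_disjoint hz ha hab
      (disjoint_sdiff_left.mono_right inter_subset_right) fa fab,
    h.lintegral_encard_mul_of_disjoint hz ha hb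
      (disjoint_sdiff_left.mono_right sdiff_subset) fa fb,
    ← measure_inter_add_sdiff A hB, ← measure_inter_add_sdiff B hA, inter_comm B A]
  ring

/-! ### Second factorial moment measure -/

/-- The second factorial moment measure of a random sequence. -/
noncomputable def secondFactorialMoment (P : Measure Ω) (z : ℕ → Ω → S) : Measure (S × S) :=
  Measure.sum fun p : ℕ × ℕ => if p.1 = p.2 then 0 else P.map fun ω => (z p.1 ω, z p.2 ω)

/-- A product of counts is a sum over all pairs of indices, whose diagonal counts `A ∩ B`. The
additive form avoids subtracting infinite values. -/
lemma secondFactorialMoment_prod_add (hz : ∀ i, Measurable (z i)) {A B : Set S}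
    (hA : MeasurableSet A) (hB : MeasurableSet B) :
    secondFactorialMoment P z (A ×ˢ B) + ∫⁻ ω, ({i | z i ω ∈ A ∩ B}.encard : ℝ≥0∞) ∂P =
      ∫⁻ ω, ({i | z i ω ∈ A}.encard : ℝ≥0∞) * {i | z i ω ∈ B}.encard ∂P := by
  have hmeas : ∀ i j, Measurable fun ω =>
      A.indicator (1 : S → ℝ≥0∞) (z i ω) * B.indicator (1 : S → ℝ≥0∞) (z j ω) := fun i j =>
    ((measurable_one.indicator hA).comp (hz i)).mul ((measurable_one.indicator hB).comp (hz j))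
  have hpair : ∀ i j, P.map (fun ω => (z i ω, z j ω)) (A ×ˢ B) =
      ∫⁻ ω, A.indicator (1 : S → ℝ≥0∞) (z i ω) * B.indicator (1 : S → ℝ≥0∞) (z j ω) ∂P := by
    intro i j
    rw [← lintegral_indicator_one (hA.prod hB),
      lintegral_map (measurable_one.indicator (hA.prod hB)) ((hz i).prodMk (hz j))]
    refine lintegral_congr fun ω => ?_
    by_cases h1 : z i ω ∈ A <;> by_cases h2 : z j ω ∈ B <;> simp [h1, h2]
  have hdiag : ∀ ω, ({i | z i ω ∈ A ∩ B}.encard : ℝ≥0∞) = ∑' p : ℕ × ℕ, if p.1 = p.2 then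
      A.indicator (1 : S → ℝ≥0∞) (z p.1 ω) * B.indicator (1 : S → ℝ≥0∞) (z p.2 ω) else 0 := by
    intro ω
    rw [← tsum_indicator_one_eq_encard fun i => z i ω, ENNReal.tsum_prod']
    refine tsum_congr fun i => ?_
    rw [tsum_eq_single i fun j hj => if_neg hj.symm, if_pos rfl]
    by_cases h1 : z i ω ∈ A <;> by_cases h2 : z i ω ∈ B <;> simp [h1, h2]
  have hprod : ∀ ω, ({i | z i ω ∈ A}.encard : ℝ≥0∞) * {i | z i ω ∈ B}.encard =
      ∑' p : ℕ × ℕ,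
        A.indicator (1 : S → ℝ≥0∞) (z p.1 ω) * B.indicator (1 : S → ℝ≥0∞) (z p.2 ω) := by
    intro ω
    rw [← tsum_indicator_one_eq_encard fun i => z i ω,
      ← tsum_indicator_one_eq_encard fun i => z i ω, ENNReal.tsum_prod',
      ← ENNReal.tsum_mul_right]
    simp_rw [ENNReal.tsum_mul_left]
  simp_rw [hdiag, hprod]
  rw [secondFactorialMoment, Measure.sum_apply _ (hA.prod hB),
    lintegral_tsum fun p => (hmeas _ _).aemeasurable, lintegral_tsum, ← ENNReal.tsum_add]
  · refine tsum_congr fun p => ?_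
    split_ifs with hp <;> simp [hpair]
  · intro p
    split_ifs
    · exact (hmeas _ _).aemeasurable
    · exact aemeasurable_const

/-- On rectangles with sides of finite measure the diagonal term cancels and leaves `μ A * μ B`. The
two measures thus agree on squares exhausting `S × S`, which is enough for null sets. -/
theorem HasPoissonLaplace.secondFactorialMoment_absolutelyContinuous [IsProbabilityMeasure P]
    [SigmaFinite μ] (h : HasPoissonLaplace P z μ) (hz : ∀ i, Measurable (z i)) :
    secondFactorialMoment P z ≪ μ.prod μ := by
  have hrect : ∀ {A B : Set S}, MeasurableSet A → MeasurableSet B → μ A ≠ ∞ → μ B ≠ ∞ →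
      secondFactorialMoment P z (A ×ˢ B) = μ A * μ B := fun {A B} hA hB hμA hμB => by
    have fab : μ (A ∩ B) ≠ ∞ := measure_ne_top_of_subset inter_subset_left hμA
    have := secondFactorialMoment_prod_add (P := P) hz hA hB
    rw [h.lintegral_encard_mul hz hA hB hμA hμB, h.lintegral_encard hz (hA.inter hB) fab] at this
    exact (ENNReal.add_left_inj fab).1 this
  intro D hD
  let Q : ℕ → Set S := spanningSets μ
  have hQ : ∀ n, MeasurableSet (Q n) := measurableSet_spanningSets μ
  have hres : ∀ n, (secondFactorialMoment P z).restrict (Q n ×ˢ Q n) =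
      (μ.prod μ).restrict (Q n ×ˢ Q n) := fun n => by
    rw [← Measure.prod_restrict]
    refine (Measure.prod_eq fun s t hs ht => ?_).symm
    have f (u : Set S) : μ (u ∩ Q n) ≠ ∞ :=
      measure_ne_top_of_subset inter_subset_right (measure_spanningSets_lt_top μ n).ne
    rw [Measure.restrict_apply (hs.prod ht), Measure.restrict_apply hs, Measure.restrict_apply ht,
      prod_inter_prod, hrect (hs.inter (hQ n)) (ht.inter (hQ n)) (f s) (f t)]
  have hcover : D ⊆ ⋃ n, D ∩ Q n ×ˢ Q n := fun p hp => by
    have h1 := mem_spanningSetsIndex μ p.1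
    have h2 := mem_spanningSetsIndex μ p.2
    refine mem_iUnion.2 ⟨max (spanningSetsIndex μ p.1) (spanningSetsIndex μ p.2), hp, ?_, ?_⟩
    · exact monotone_spanningSets μ (le_max_left _ _) h1
    · exact monotone_spanningSets μ (le_max_right _ _) h2
  refine measure_mono_null hcover (measure_iUnion_null fun n => ?_)
  rw [← Measure.restrict_apply' ((hQ n).prod (hQ n)), hres,
    Measure.restrict_apply' ((hQ n).prod (hQ n))]
  exact measure_mono_null inter_subset_left hD

end

/-! ### Mapping and marking theorems -/

section

variable {Ω S : Type*} [MeasurableSpace Ω] [MeasurableSpace S] {P : Measure Ω}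
  [IsProbabilityMeasure P] {z : ℕ → Ω → S} {μ : Measure S}

/-- The images of the points of a Poisson process under a map with diffuse image measure are
almost surely distinct. -/
theorem HasPoissonLaplace.ae_injOn {T : Type*} [MeasurableSpace T] [MeasurableEq T]
    [SigmaFinite μ] (h : HasPoissonLaplace P z μ) (hz : ∀ i, Measurable (z i)) {g : S → T}
    (hg : Measurable g) {A : Set S} (hA : MeasurableSet A)
    (hdiff : ∀ t, μ (A ∩ g ⁻¹' {t}) = 0) :
    ∀ᵐ ω ∂P, InjOn (fun i => g (z i ω)) {i | z i ω ∈ A} := by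
  let D : Set (S × S) := {p | p.1 ∈ A ∧ p.2 ∈ A ∧ g p.1 = g p.2}
  have hD : MeasurableSet D := (measurable_fst hA).inter ((measurable_snd hA).inter
    (measurableSet_eq_fun (hg.comp measurable_fst) (hg.comp measurable_snd)))
  -- Each slice of `D` lies in a fibre of `g` within `A`, hence is null; Fubini then makes `D` null.
  have hD0 : secondFactorialMoment P z D = 0 := by
    refine h.secondFactorialMoment_absolutelyContinuous hz ?_
    rw [Measure.prod_apply hD, lintegral_eq_zero_iff (measurable_measure_prodMk_left hD)]
    exact .of_forall fun x => measure_mono_null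
      (show Prod.mk x ⁻¹' D ⊆ A ∩ g ⁻¹' {g x} from fun y hy => ⟨hy.2.1, hy.2.2.symm⟩) (hdiff (g x))
  rw [secondFactorialMoment, Measure.sum_apply _ hD, ENNReal.tsum_eq_zero] at hD0
  have hpair : ∀ i j, i ≠ j → ∀ᵐ ω ∂P, (z i ω, z j ω) ∉ D := fun i j hij => by
    have := hD0 (i, j)
    rw [if_neg hij, Measure.map_apply ((hz i).prodMk (hz j)) hD] at this
    exact measure_eq_zero_iff_ae_notMem.1 this
  have hall : ∀ᵐ ω ∂P, ∀ i j, i ≠ j → (z i ω, z j ω) ∉ D :=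
    ae_all_iff.2 fun i => ae_all_iff.2 fun j => by
      by_cases hij : i = j
      · exact .of_forall fun ω h => absurd hij h
      · exact (hpair i j hij).mono fun ω h _ => h
  filter_upwards [hall] with ω hω i hi j hj hij
  by_contra hne
  exact hω i j hne ⟨hi, hj, hij⟩

/-- The number of points in a measurable set of a random countable set that is listed with
possible repetitions is measurable. -/
lemma measurable_pointCount_image {T : Type*} [MeasurableSpace T] [MeasurableEq T]
    (hz : ∀ i, Measurable (z i)) {g : S → T} (hg : Measurable g) {A : Set S}
    (hA : MeasurableSet A) {B : Set T} (hB : MeasurableSet B) :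
    Measurable (pointCount (fun ω => {t | ∃ i, z i ω ∈ A ∧ t = g (z i ω)}) B) := by
  -- Keeping only the least index of each value makes the count exact for every `ω`, including those
  -- where image points coincide.
  let J : Ω → Set ℕ := fun ω =>
    {i | (z i ω ∈ A ∧ g (z i ω) ∈ B) ∧ ∀ j < i, z j ω ∈ A → g (z j ω) ≠ g (z i ω)}
  have hJ : pointCount (fun ω => {t | ∃ i, z i ω ∈ A ∧ t = g (z i ω)}) B =
      fun ω => (J ω).encard := by
    funext ω
    have hinj : InjOn (fun i => g (z i ω)) (J ω) := by
      intro i hi j hj hij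
      rcases lt_trichotomy i j with hlt | heq | hlt
      · exact absurd hij (hj.2 i hlt hi.1.1)
      · exact heq
      · exact absurd hij.symm (hi.2 j hlt hj.1.1)
    rw [pointCount, ← hinj.encard_image]
    congr 1
    ext t
    constructor
    · rintro ⟨hex, ht⟩
      classical
      obtain ⟨hi, hti⟩ := Nat.find_spec hex
      refine ⟨Nat.find hex, ⟨⟨hi, hti ▸ ht⟩, fun j hj hjA hjt => ?_⟩, hti.symm⟩
      exact Nat.find_min hex hj ⟨hjA, hti.trans hjt.symm⟩
    · rintro ⟨i, hi, rfl⟩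
      exact ⟨⟨i, hi.1.1, rfl⟩, hi.1.2⟩
  rw [hJ]
  refine measurable_encard.comp (measurable_set_iff.2 fun i => measurableSet_setOfPred.1 ?_)
  refine ((hz i hA).inter (hz i (hg hB))).inter ?_
  have : {ω | ∀ j < i, z j ω ∈ A → g (z j ω) ≠ g (z i ω)} =
      ⋂ j, ⋂ (_ : j < i), (z j ⁻¹' A)ᶜ ∪ {ω | g (z j ω) = g (z i ω)}ᶜ := by
    ext ω
    simp [imp_iff_not_or]
  change MeasurableSet {ω | ∀ j < i, z j ω ∈ A → g (z j ω) ≠ g (z i ω)}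
  rw [this]
  exact .iInter fun j => .iInter fun _ => (hz j hA).compl.union
    (measurableSet_eq_fun (hg.comp (hz j)) (hg.comp (hz i))).compl

/-- The mapping theorem: the image of a Poisson process under a map with diffuse image measure is
a Poisson process. -/
theorem HasPoissonLaplace.isPoissonProcess_image {T : Type*} [MeasurableSpace T] [MeasurableEq T]
    [SigmaFinite μ] (h : HasPoissonLaplace P z μ) (hz : ∀ i, Measurable (z i)) {g : S → T}
    (hg : Measurable g) {A : Set S} (hA : MeasurableSet A)
    (hdiff : ∀ t, μ (A ∩ g ⁻¹' {t}) = 0) :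
    IsPoissonProcess P (fun ω => {t | ∃ i, z i ω ∈ A ∧ t = g (z i ω)})
      ((μ.restrict A).map g) := by
  have hcount : ∀ B : Set T, pointCount (fun ω => {t | ∃ i, z i ω ∈ A ∧ t = g (z i ω)}) B
      =ᵐ[P] fun ω => {i | z i ω ∈ A ∩ g ⁻¹' B}.encard := fun B => by
    filter_upwards [h.ae_injOn hz hg hA hdiff] with ω hω
    have hω' : InjOn (fun i => g (z i ω)) {i | z i ω ∈ A ∩ g ⁻¹' B} := hω.mono fun i hi => hi.1
    rw [pointCount, ← hω'.encard_image]
    congr 1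
    ext t
    constructor
    · rintro ⟨⟨i, hi, rfl⟩, ht⟩
      exact ⟨i, ⟨hi, ht⟩, rfl⟩
    · rintro ⟨i, hi, rfl⟩
      exact ⟨⟨i, hi.1, rfl⟩, hi.2⟩
  refine ⟨fun ω => ?_, fun B hB => measurable_pointCount_image hz hg hA hB, fun B hB => ?_,
    fun n B hB hdisj => ?_⟩
  · refine (countable_range fun i => g (z i ω)).mono ?_
    rintro _ ⟨i, _, rfl⟩
    exact ⟨i, rfl⟩
  · rw [Measure.map_congr (hcount B), h.map_encard_eq_poissonLaw hz (hA.inter (hg hB)),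
      Measure.map_apply hg hB, Measure.restrict_apply (hg hB), inter_comm]
  · exact (h.iIndepFun_encard hz (fun k => hA.inter (hg (hB k))) fun k l hkl =>
      ((hdisj hkl).preimage g).mono inter_subset_right inter_subset_right).congr
      fun k => (hcount (B k)).symm

/-- Once the locations are frozen, the factors depend on distinct independent marks, so each mark is
averaged separately. -/
lemma lintegral_prod_marked {T : Type*} [MeasurableSpace T] {F : Measure T} {f : ℕ → Ω → T}
    (hz : ∀ i, Measurable (z i)) (hf : ∀ i, Measurable (f i)) (hf_law : ∀ i, P.map (f i) = F)
    (hf_indep : iIndepFun f P) (hzf_indep : IndepFun (fun ω i => z i ω) (fun ω i => f i ω) P)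
    {h : S × T → ℝ≥0∞} (hh : Measurable h) (n : ℕ) :
    ∫⁻ ω, ∏ i ∈ Finset.range n, h (z i ω, f i ω) ∂P =
      ∫⁻ ω, ∏ i ∈ Finset.range n, ∫⁻ t, h (z i ω, t) ∂F ∂P := by
  have hz' : Measurable fun ω i => z i ω := measurable_pi_lambda _ hz
  have hf' : Measurable fun ω i => f i ω := measurable_pi_lambda _ hf
  have hF : IsProbabilityMeasure F :=
    hf_law 0 ▸ Measure.isProbabilityMeasure_map (hf 0).aemeasurable
  have hfm := Measure.isProbabilityMeasure_map (μ := P) hf'.aemeasurable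
  have hH : Measurable fun x => ∫⁻ t, h (x, t) ∂F := hh.lintegral_prod_right'
  have hG : Measurable fun p : (ℕ → S) × (ℕ → T) => ∏ i ∈ Finset.range n, h (p.1 i, p.2 i) := by
    fun_prop
  calc ∫⁻ ω, ∏ i ∈ Finset.range n, h (z i ω, f i ω) ∂P
      = ∫⁻ p, ∏ i ∈ Finset.range n, h (p.1 i, p.2 i)
          ∂P.map (fun ω => ((fun i => z i ω), (fun i => f i ω))) := by
        rw [lintegral_map hG (hz'.prodMk hf')]
    _ = ∫⁻ a, ∫⁻ b, ∏ i ∈ Finset.range n, h (a i, b i) ∂P.map (fun ω i => f i ω)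
          ∂P.map (fun ω i => z i ω) := by
        rw [(indepFun_iff_map_prod_eq_prod_map_map hz'.aemeasurable hf'.aemeasurable).1 hzf_indep,
          lintegral_prod _ hG.aemeasurable]
    _ = ∫⁻ a, ∏ i ∈ Finset.range n, ∫⁻ t, h (a i, t) ∂F ∂P.map (fun ω i => z i ω) := by
        refine lintegral_congr fun a => ?_
        rw [lintegral_map (by fun_prop) hf',
          lintegral_prod_eq_prod_lintegral_of_indepFun _ (fun i ω => h (a i, f i ω))
            (hf_indep.comp (fun i t => h (a i, t)) fun i => by fun_prop) fun i => by fun_prop]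
        refine Finset.prod_congr rfl fun i _ => ?_
        rw [← hf_law i, lintegral_map (by fun_prop) (hf i)]
    _ = ∫⁻ ω, ∏ i ∈ Finset.range n, ∫⁻ t, h (z i ω, t) ∂F ∂P := by
        rw [lintegral_map (by fun_prop) hz']

/-- The marking theorem: independent marks turn a Poisson process into a Poisson process on the
product space. -/
theorem HasPoissonLaplace.marked [SFinite μ] {T : Type*} [MeasurableSpace T] {F : Measure T}
    {f : ℕ → Ω → T} (h : HasPoissonLaplace P z μ)
    (hz : ∀ i, Measurable (z i)) (hf : ∀ i, Measurable (f i)) (hf_law : ∀ i, P.map (f i) = F)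
    (hf_indep : iIndepFun f P)
    (hzf_indep : IndepFun (fun ω i => z i ω) (fun ω i => f i ω) P) :
    HasPoissonLaplace P (fun i ω => (z i ω, f i ω)) (μ.prod F) := by
  have hF : IsProbabilityMeasure F :=
    hf_law 0 ▸ Measure.isProbabilityMeasure_map (hf 0).aemeasurable
  intro v hv
  let H : S → ℝ≥0∞ := fun x => ∫⁻ t, expNeg (v (x, t)) ∂F
  have hH : Measurable H := (measurable_expNeg.comp hv).lintegral_prod_right'
  have hH1 : ∀ x, H x ≤ 1 := fun x =>
    (lintegral_mono fun t => expNeg_le_one _).trans_eq (by simp)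
  -- Averaging the marks replaces `v` by the function `negLog ∘ H` of the location alone; finite
  -- products pass to the limit since partial sums converge in `[0, ∞]`.
  have heq : ∫⁻ ω, expNeg (∑' i, v (z i ω, f i ω)) ∂P =
      ∫⁻ ω, expNeg (∑' i, negLog (H (z i ω))) ∂P := by
    refine tendsto_nhds_unique (tendsto_lintegral_expNeg
      (T := fun n ω => ∑ i ∈ Finset.range n, v (z i ω, f i ω)) (fun n => by fun_prop)
      fun ω => ENNReal.tendsto_nat_tsum _) ?_
    have := tendsto_lintegral_expNeg (P := P)
      (T := fun n ω => ∑ i ∈ Finset.range n, negLog (H (z i ω))) (fun n => by fun_prop)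
      fun ω => ENNReal.tendsto_nat_tsum _
    simp_rw [expNeg_sum, expNeg_negLog (hH1 _)] at this ⊢
    refine this.congr fun n => ?_
    exact (lintegral_prod_marked hz hf hf_law hf_indep hzf_indep (measurable_expNeg.comp hv) n).symm
  rw [heq, h (fun x => negLog (H x)) (by fun_prop), lintegral_prod _ (by fun_prop)]
  congr 1
  refine lintegral_congr fun x => ?_
  rw [expNeg_negLog (hH1 x), lintegral_sub (by fun_prop)
    ((hH1 x).trans_lt ENNReal.one_lt_top).ne (.of_forall fun t => expNeg_le_one _)]
  simp [H]

end

/-- The restriction of a Poisson process to a measurable set. -/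
lemma IsPoissonProcess.inter {Ω S : Type*} [MeasurableSpace Ω] [MeasurableSpace S]
    {P : Measure Ω} {X : Ω → Set S} {μ : Measure S} (h : IsPoissonProcess P X μ) {A : Set S}
    (hA : MeasurableSet A) : IsPoissonProcess P (fun ω => X ω ∩ A) (μ.restrict A) := by
  have hcount : ∀ B, pointCount (fun ω => X ω ∩ A) B = pointCount X (B ∩ A) := fun B => by
    funext ω
    rw [pointCount, pointCount, inter_assoc, inter_comm A]
  refine ⟨fun ω => (h.countable ω).mono inter_subset_left, fun B hB => ?_, fun B hB => ?_,
    fun n B hB hdisj => ?_⟩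
  · rw [hcount]
    exact h.measurable_count _ (hB.inter hA)
  · rw [hcount, h.law_count _ (hB.inter hA), Measure.restrict_apply hB]
  · simp_rw [hcount]
    exact h.indep_count n _ (fun k => (hB k).inter hA)
      fun k l hkl => (hdisj hkl).mono inter_subset_left inter_subset_left

/-! ### Path loss with fading: mean measure and Poisson property -/

section

variable {d : ℕ} {α : ℝ}

/-- The path loss with fading of a node with a given location and fading. -/
noncomputable def fadingPathLoss (α : ℝ) (p : EuclideanSpace ℝ (Fin d) × ℝ) : ℝ :=
  ‖p.1‖ ^ α / p.2

lemma measurable_fadingPathLoss : Measurable (fadingPathLoss (d := d) α) := by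
  unfold fadingPathLoss
  fun_prop

/-- The nodes with positive fading. -/
def positiveFading (d : ℕ) : Set (EuclideanSpace ℝ (Fin d) × ℝ) := {p | 0 < p.2}

lemma measurableSet_positiveFading : MeasurableSet (positiveFading d) :=
  measurableSet_lt measurable_const measurable_snd

/-- The mean measure of the path loss process with fading distribution `F`. -/
noncomputable def fadingMeanMeasure (d : ℕ) (α : ℝ) (F : Measure ℝ) : Measure ℝ :=
  (((volume : Measure (EuclideanSpace ℝ (Fin d))).prod F).restrict (positiveFading d)).map
    (fadingPathLoss α)

lemma fadingMeanMeasure_apply (F : Measure ℝ) [SFinite F] {B : Set ℝ} (hB : MeasurableSet B) :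
    fadingMeanMeasure d α F B = ∫⁻ u, volume {x : EuclideanSpace ℝ (Fin d) |
      ‖x‖ ^ α / u ∈ B ∧ 0 < u} ∂F := by
  have hm := measurable_fadingPathLoss (d := d) (α := α) hB
  rw [fadingMeanMeasure, Measure.map_apply measurable_fadingPathLoss hB,
    Measure.restrict_apply hm,
    Measure.prod_apply_symm (hm.inter measurableSet_positiveFading)]
  rfl

/-- For fixed `u > 0` the locations with path loss `t` lie on a sphere. It is null because `d` is
positive; in dimension `0` the origin would be an atom. -/
lemma fadingMeanMeasure_singleton (hd : 0 < d) (hα : 0 < α) (F : Measure ℝ) [SFinite F] (t : ℝ) :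
    fadingMeanMeasure d α F {t} = 0 := by
  have : Nonempty (Fin d) := ⟨⟨0, hd⟩⟩
  rw [fadingMeanMeasure_apply F (measurableSet_singleton t)]
  refine lintegral_eq_zero_of_ae_eq_zero (.of_forall fun u => ?_)
  refine measure_mono_null ?_ (Measure.addHaar_sphere volume 0 ((t * u) ^ α⁻¹))
  rintro x ⟨hx, hu⟩
  rw [mem_singleton_iff, div_eq_iff hu.ne'] at hx
  rw [mem_sphere_zero_iff_norm, ← hx, Real.rpow_rpow_inv (norm_nonneg x) hα.ne']

lemma fadingMeanMeasure_Iio_zero (F : Measure ℝ) [SFinite F] :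
    fadingMeanMeasure d α F (Iio 0) = 0 := by
  rw [fadingMeanMeasure_apply F measurableSet_Iio]
  refine lintegral_eq_zero_of_ae_eq_zero (.of_forall fun u => ?_)
  refine measure_mono_null ?_ measure_empty
  rintro x ⟨hx, hu⟩
  have : 0 ≤ ‖x‖ ^ α / u := by positivity
  exact absurd hx (not_lt.2 this)

/-- For fading `u`, path loss below `r > 0` confines the node to a ball of radius `(r * u) ^ α⁻¹`,
whose volume is proportional to `(r * u) ^ (d / α)`; the moment hypothesis integrates this bound. -/
lemma isLocallyFiniteMeasure_fadingMeanMeasure (hα : 0 < α) (F : Measure ℝ) [SFinite F]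
    (hF : Integrable (fun x : ℝ => x ^ ((d : ℝ) / α)) F) :
    IsLocallyFiniteMeasure (fadingMeanMeasure d α F) := by
  refine ⟨fun x => ⟨Iio (x + 1), Iio_mem_nhds (lt_add_one x), ?_⟩⟩
  rw [fadingMeanMeasure_apply F measurableSet_Iio]
  -- The absolute value keeps the base of the real power nonnegative when `x + 1 < 0`.
  set b := |x + 1|
  have hbound : ∀ u : ℝ, volume {y : EuclideanSpace ℝ (Fin d) |
      ‖y‖ ^ α / u ∈ Iio (x + 1) ∧ 0 < u} ≤
      ENNReal.ofReal (b ^ ((d : ℝ) / α) * u ^ ((d : ℝ) / α)) *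
        volume (Metric.ball (0 : EuclideanSpace ℝ (Fin d)) 1) := fun u => by
    rcases le_or_gt u 0 with hu | hu
    · simp [hu.not_gt]
    have hb : 0 ≤ b := abs_nonneg _
    have hr : b ^ ((d : ℝ) / α) * u ^ ((d : ℝ) / α) = ((b * u) ^ α⁻¹) ^ d := by
      rw [← Real.mul_rpow hb hu.le, ← Real.rpow_natCast, ← Real.rpow_mul (by positivity)]
      congr 1
      field_simp
    have hball := Measure.addHaar_closedBall (volume : Measure (EuclideanSpace ℝ (Fin d))) 0
      (r := (b * u) ^ α⁻¹) (by positivity)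
    rw [finrank_euclideanSpace_fin] at hball
    rw [hr, ← hball]
    refine measure_mono ?_
    rintro y ⟨hy, -⟩
    rw [mem_Iio, div_lt_iff₀ hu] at hy
    rw [mem_closedBall_zero_iff, ← Real.rpow_rpow_inv (norm_nonneg y) hα.ne']
    refine Real.rpow_le_rpow (by positivity) (hy.le.trans ?_) (by positivity)
    gcongr
    exact le_abs_self _
  refine (lintegral_mono hbound).trans_lt ?_
  rw [lintegral_mul_const' _ _ measure_ball_lt_top.ne]
  exact ENNReal.mul_lt_top (hF.const_mul _).lintegral_lt_top measure_ball_lt_top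

theorem isPoissonProcess_fadingPathLossProcess {Ω : Type*} [MeasurableSpace Ω] {P : Measure Ω}
    [IsProbabilityMeasure P] (hd : 0 < d) (hα : 0 < α)
    {y : ℕ → Ω → EuclideanSpace ℝ (Fin d)} (hy : ∀ i, Measurable (y i))
    (hy_laplace : HasPoissonLaplace P y volume) {F : Measure ℝ}
    {f : ℕ → Ω → ℝ} (hf : ∀ i, Measurable (f i)) (hf_law : ∀ i, P.map (f i) = F)
    (hf_indep : iIndepFun f P)
    (hyf_indep : IndepFun (fun ω i => y i ω) (fun ω i => f i ω) P) :
    IsPoissonProcess P (fadingPathLossProcess α y f) (fadingMeanMeasure d α F) := by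
  have hF : IsProbabilityMeasure F :=
    hf_law 0 ▸ Measure.isProbabilityMeasure_map (hf 0).aemeasurable
  refine (hy_laplace.marked hy hf hf_law hf_indep hyf_indep).isPoissonProcess_image
    (fun i => (hy i).prodMk (hf i)) measurable_fadingPathLoss measurableSet_positiveFading
    fun t => ?_
  rw [inter_comm, ← Measure.restrict_apply
      (measurable_fadingPathLoss (measurableSet_singleton t)),
    ← Measure.map_apply measurable_fadingPathLoss (measurableSet_singleton t)]
  exact fadingMeanMeasure_singleton hd hα F t

end

lemma iIndepFun_const_one {Ω ι : Type*} [MeasurableSpace Ω] (P : Measure Ω)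
    [IsProbabilityMeasure P] : iIndepFun (fun (_ : ι) (_ : Ω) => (1 : ℝ)) P := by
  rw [iIndepFun_iff_measure_inter_preimage_eq_mul]
  intro s A _
  by_cases h : ∀ i ∈ s, (1 : ℝ) ∈ A i
  · have h' : ⋂ i ∈ s, (fun _ : Ω => (1 : ℝ)) ⁻¹' A i = univ :=
      eq_univ_of_forall fun ω => mem_iInter₂.2 h
    rw [h', measure_univ, Finset.prod_eq_one fun i hi => ?_]
    rw [preimage_const_of_mem (h i hi), measure_univ]
  · push Not at h
    obtain ⟨i, hi, hiA⟩ := h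
    rw [Finset.prod_eq_zero hi (by rw [preimage_const_of_notMem hiA, measure_empty])]
    exact measure_mono_null (biInter_subset_of_mem hi)
      (by rw [preimage_const_of_notMem hiA, measure_empty])

theorem proposition1 {Ω : Type*} [MeasurableSpace Ω] (P : Measure Ω) [IsProbabilityMeasure P]
    (d : ℕ) (hd : 0 < d) (α : ℝ) (hα : 0 < α) (s : ℝ) (hs : 0 < s)
    -- the nodes: a stationary Poisson process of intensity 1, listed by distance to the origin
    (y : ℕ → Ω → EuclideanSpace ℝ (Fin d)) (hy : ∀ i, Measurable (y i))
    (hy_poisson : IsPoissonProcess P (fun ω => range (fun i => y i ω)) volume)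
    (hy_inj : ∀ᵐ ω ∂P, Function.Injective (fun i => y i ω))
    (hy_mono : ∀ᵐ ω ∂P, Monotone (fun i => ‖y i ω‖))
    -- the fading: iid with law F on the nonnegative reals, of mean 1, independent of the nodes
    (F : Measure ℝ) (hF_supp : F (Iio 0) = 0) (hF_mean : ∫ x, x ∂F = 1)
    (f : ℕ → Ω → ℝ) (hf : ∀ i, Measurable (f i)) (hf_law : ∀ i, P.map (f i) = F)
    (hf_indep : iIndepFun f P)
    (hyf_indep : IndepFun (fun ω i => y i ω) (fun ω i => f i ω) P) :
    ∃ Λ M : Measure ℝ,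
      Λ (Iio 0) = 0 ∧ IsLocallyFiniteMeasure Λ ∧
      M (Iio 0) = 0 ∧
      (Integrable (fun x : ℝ => x ^ ((d : ℝ) / α)) F → IsLocallyFiniteMeasure M) ∧
      IsPoissonProcess P (pathLossProcess α y) Λ ∧
      IsPoissonProcess P (fadingPathLossProcess α y f) M ∧
      IsPoissonProcess P (connectedFadingPathLossProcess α s y f)
        (M.restrict (Ico 0 (1 / s))) := by
  have hF : IsProbabilityMeasure F :=
    hf_law 0 ▸ Measure.isProbabilityMeasure_map (hf 0).aemeasurable
  have hlap : HasPoissonLaplace P y volume := hy_poisson.hasPoissonLaplace hy hy_inj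
  have hΞ : IsPoissonProcess P (fadingPathLossProcess α y f) (fadingMeanMeasure d α F) :=
    isPoissonProcess_fadingPathLossProcess hd hα hy hlap hf hf_law hf_indep hyf_indep
  -- The unfaded process has fading law `dirac 1`, for which the moment condition is trivial.
  refine ⟨fadingMeanMeasure d α (Measure.dirac 1), fadingMeanMeasure d α F,
    fadingMeanMeasure_Iio_zero _, ?_, fadingMeanMeasure_Iio_zero _,
    isLocallyFiniteMeasure_fadingMeanMeasure hα F, ?_, hΞ, hΞ.inter measurableSet_Ico⟩
  · exact isLocallyFiniteMeasure_fadingMeanMeasure hα _ (integrable_dirac (by simp))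
  · have h : pathLossProcess α y = fadingPathLossProcess α y fun _ _ => 1 := by
      funext ω
      simp [pathLossProcess, fadingPathLossProcess]
    rw [h]
    exact isPoissonProcess_fadingPathLossProcess hd hα hy hlap (fun _ => measurable_const)
      (fun _ => by simp) (iIndepFun_const_one P) (indepFun_const_right _ _)
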